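/- Let $X$ be a non-empty compact metric space with distance $d$ and let $T\colon X\to X$ be a homeomorphism. Suppose that $(X,T)$ is minimal (for every $x\in X$ the orbit $\{T^nx : n\in\mathbb Z\}$ is dense in $X$) and distal ($\inf_{n\in\mathbb Z} d(T^nx,T^ny)>0$ for all $x\neq y$ in $X$). Let $\mathcal P\subset X^4$ be the set of parallelograms of $X$, that is, the closure in $X^4$ of $$\{(x,T^mx,T^nx,T^{m+n}x) : x\in X,\ m,n\in\mathbb Z\}.$$ A factor of $(X,T)$ is a system $(Y,S)$ ($Y$ compact metrizable, $S$ a homeomorphism of $Y$) with a continuous surjection $p\colon X\to Y$ such that $S\circ p=p\circ T$; it is equicontinuous if the family $(S^n)_{n\in\mathbb Z}$ is uniformly equicontinuous. The maximal equicontinuous factor $\pi\colon X\to Z$ of $(X,T)$ is the equicontinuous factor through which every equicontinuous factor $p\colon X\to Y$ factors, that is, $p=q\circ\pi$ for a factor map $q\colon Z\to Y$. Then $(X,T)$ has a maximal equicontinuous factor, and it can be realized as a rotation $z\mapsto\alpha z$ on a compact metrizable abelian group $Z$. Moreover, for every such realization $\pi\colon X\to Z$ and every $(x_0,x_1,x_2,x_3)\in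 X^4$: 1. $(x_0,x_1,x_2,x_3)\in\mathcal P$ if and only if $\pi(x_0)\,\pi(x_1)^{-1}\,\pi(x_2)^{-1}\,\pi(x_3)=1$ in $Z$. 2. $(x_0,x_1,x_2,x_3)\in\mathcal P$ if and only if there are two sequences of integers $(m_i)$ and $(n_i)$ with $T^{m_i}x_0\to x_1$, $T^{n_i}x_0\to x_2$ and $T^{m_i+n_i}x_0\to x_3$. -/

import Mathlib

open Filter Topology

universe u v

namespace TopDyn

/-- The system `(X, T)` is minimal: every two-sided orbit is dense. -/
def IsMinimalSystem {X : Type u} [TopologicalSpace X] (T : X ≃ₜ X) : Prop :=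
  ∀ x : X, Dense (Set.range fun n : ℤ => (T ^ n) x)

/-- The system `(X, T)` is distal: `inf_n d(Tⁿ x, Tⁿ y) > 0` for all `x ≠ y`. -/
def IsDistalSystem {X : Type u} [MetricSpace X] (T : X ≃ₜ X) : Prop :=
  ∀ x y : X, x ≠ y → 0 < ⨅ n : ℤ, dist ((T ^ n) x) ((T ^ n) y)

/-- The system `(X, T)` is equicontinuous: the family `(Tⁿ)`, `n ∈ ℤ`, is uniformly
equicontinuous. -/
def IsEquicontinuousSystem {X : Type u} [MetricSpace X] (T : X ≃ₜ X) : Prop :=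
  UniformEquicontinuous fun (n : ℤ) (x : X) => (T ^ n) x

/-- `p : X → Y` is a factor map from `(X, T)` to `(Y, S)`. -/
structure IsFactorMap {X : Type u} {Y : Type v} [TopologicalSpace X] [TopologicalSpace Y]
    (T : X ≃ₜ X) (S : Y ≃ₜ Y) (p : X → Y) : Prop where
  continuous : Continuous p
  surjective : Function.Surjective p
  semiconj : ∀ x, p (T x) = S (p x)

/-- `π : X → Z` exhibits `(Z, S)` as the maximal equicontinuous factor of `(X, T)`: it is an
equicontinuous factor, and it lies above every equicontinuous factor `(Y, R)` of `(X, T)`.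
(Every factor of `X` is a quotient of `X`, so it suffices to let `Y` range over the universe
of `X`.) -/
structure IsMaximalEquicontinuousFactor {X : Type u} {Z : Type v}
    [MetricSpace X] [MetricSpace Z] (T : X ≃ₜ X) (S : Z ≃ₜ Z) (π : X → Z) : Prop where
  isFactorMap : IsFactorMap T S π
  equicontinuous : IsEquicontinuousSystem S
  maximal : ∀ (Y : Type u) [MetricSpace Y] [CompactSpace Y] (R : Y ≃ₜ Y) (p : X → Y),
    IsFactorMap T R p → IsEquicontinuousSystem R →
      ∃ q : Z → Y, IsFactorMap S R q ∧ ∀ x, q (π x) = p x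

/-- The set of (dynamical) parallelograms of `(X, T)`: the closure in `X⁴` of the set of the
points `(x, Tᵐ x, Tⁿ x, Tᵐ⁺ⁿ x)`. -/
def parallelograms {X : Type u} [TopologicalSpace X] (T : X ≃ₜ X) : Set (X × X × X × X) :=
  closure {w | ∃ (x : X) (m n : ℤ), w = (x, (T ^ m) x, (T ^ n) x, (T ^ (m + n)) x)}

end TopDyn

/-! Call the pairs `(x₀, x₁)` and `(x₂, x₃)` parallel when they form a parallelogram. By minimality,
`𝒫` is the orbit closure of any diagonal point under the group generated by the diagonal and face
transformations of `X⁴`. That action is distal, and orbit closures of a distal action partition the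
space (`mem_closure_symm`, by Ellis's idempotent argument). Applied to `X⁶`, this makes parallelism
transitive (`parallelograms_trans`).

Fix `e` and identify `x` with `y` when `(e, x, e, y) ∈ 𝒫`. The relation is closed, and the fourth
vertex of `(e, x, y, ·)` is unique modulo it, which defines the product of a compact abelian group
on which `T` acts as translation by the class of `T e`. An equicontinuous factor cannot separate
identified points, so this rotation is the maximal equicontinuous factor. Claim 1 follows by
comparing any other realization with it.

For claim 2 the first vertex must stay fixed, so only two face transformations are available. A
Baire category argument (`exists_generic_pair`) gives pairs whose `T × T`-orbit closure is a whole
parallelism class; through such pairs every parallelogram at `x` is reached from `(x, x, x, x)`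
(`mem_closure_faceAction_diag`). -/

namespace TopDyn

/-! ### Closed quotients of compact metrizable spaces -/

section Quotient

variable {X : Type u} {Z : Type v} [TopologicalSpace X] [TopologicalSpace Z]

/-- A point in the closure of the range of `f ∘ u` lifts to the closure of the range of `u`. -/
theorem exists_mem_closure_range_lift [CompactSpace X] [T2Space Z] {ι : Type*} {f : X → Z}
    (hf : Continuous f) (u : ι → X) {z : Z} (hz : z ∈ closure (Set.range fun i => f (u i))) :
    ∃ x ∈ closure (Set.range u), f x = z := by
  have hcl : IsClosed (f '' closure (Set.range u)) :=
    (isClosed_closure.isCompact.image hf).isClosed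
  refine closure_minimal ?_ hcl hz
  rintro _ ⟨i, rfl⟩
  exact ⟨u i, subset_closure ⟨i, rfl⟩, rfl⟩

/-- The quotient map of a compact space by a closed equivalence relation is closed. -/
theorem isClosedMap_quotient_mk [CompactSpace X] (s : Setoid X)
    (hs : IsClosed {p : X × X | s p.1 p.2}) : IsClosedMap (Quotient.mk s) := by
  intro C hC
  rw [← (isQuotientMap_quotient_mk' (s := s)).isClosed_preimage]
  have h : (Quotient.mk s) ⁻¹' (Quotient.mk s '' C) =
      Prod.snd '' ({p : X × X | s p.1 p.2} ∩ Prod.fst ⁻¹' C) := by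
    ext y
    constructor
    · rintro ⟨x, hx, hxy⟩
      exact ⟨(x, y), ⟨Quotient.exact hxy, hx⟩, rfl⟩
    · rintro ⟨⟨x, y⟩, ⟨hxy, hx⟩, rfl⟩
      exact ⟨x, hx, Quotient.sound hxy⟩
  change IsClosed ((Quotient.mk s) ⁻¹' (Quotient.mk s '' C))
  rw [h]
  exact isClosedMap_snd_of_compactSpace _ (hs.inter (hC.preimage continuous_fst))

/-- A closed continuous surjection separates points with disjoint fibres: its codomain is
Hausdorff when the domain is compact Hausdorff. -/
theorem t2Space_of_isClosedMap [CompactSpace X] [T2Space X] {f : X → Z} (hf : Continuous f)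
    (hc : IsClosedMap f) (hs : Function.Surjective f) : T2Space Z := by
  have hpt : ∀ z : Z, IsClosed ({z} : Set Z) := fun z => by
    obtain ⟨x, rfl⟩ := hs z
    simpa using hc _ (isClosed_singleton (x := x))
  refine ⟨fun a b hab => ?_⟩
  have hdisj : Disjoint (f ⁻¹' {a}) (f ⁻¹' {b}) :=
    Disjoint.preimage f (Set.disjoint_singleton.2 hab)
  obtain ⟨U, V, hU, hV, haU, hbV, hUV⟩ := SeparatedNhds.of_isCompact_isCompact
    ((hpt a).preimage hf).isCompact ((hpt b).preimage hf).isCompact hdisj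
  -- `(f '' Uᶜ)ᶜ` is the set of points whose whole fibre lies in `U`; it is open because `f` is
  -- closed.
  refine ⟨(f '' Uᶜ)ᶜ, (f '' Vᶜ)ᶜ, (hc _ hU.isClosed_compl).isOpen_compl,
    (hc _ hV.isClosed_compl).isOpen_compl, ?_, ?_, ?_⟩
  · rintro ⟨x, hx, hxa⟩
    exact hx (haU hxa)
  · rintro ⟨x, hx, hxb⟩
    exact hx (hbV hxb)
  · rw [Set.disjoint_left]
    intro z hzU hzV
    obtain ⟨x, rfl⟩ := hs z
    have hxU : x ∈ U := by
      by_contra h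
      exact hzU ⟨x, h, rfl⟩
    have hxV : x ∈ V := by
      by_contra h
      exact hzV ⟨x, h, rfl⟩
    exact Set.disjoint_left.1 hUV hxU hxV

/-- The image of a compact second countable space under a closed continuous surjection onto a
`T1` space is second countable. -/
theorem secondCountableTopology_of_isClosedMap [CompactSpace X] [SecondCountableTopology X]
    [T1Space Z] {f : X → Z} (hf : Continuous f) (hc : IsClosedMap f)
    (hs : Function.Surjective f) : SecondCountableTopology Z := by
  let B := TopologicalSpace.countableBasis X
  let 𝒞 : Set (Set Z) := (fun F : Set (Set X) => (f '' (⋃₀ F)ᶜ)ᶜ) '' {F | F.Finite ∧ F ⊆ B}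
  have hB : ∀ U ∈ B, IsOpen U := fun U hU => TopologicalSpace.isOpen_of_mem_countableBasis hU
  have hbasis : TopologicalSpace.IsTopologicalBasis 𝒞 := by
    refine TopologicalSpace.isTopologicalBasis_of_isOpen_of_nhds ?_ ?_
    · rintro _ ⟨F, ⟨-, hF⟩, rfl⟩
      exact (hc _ (isOpen_sUnion fun U hU => hB U (hF hU)).isClosed_compl).isOpen_compl
    · intro z U hzU hU
      -- Fibres are compact, so finitely many basic sets inside `f ⁻¹' U` already cover the fibre of
      -- `z`; this is why finite families suffice in `𝒞`.
      have hcomp : IsCompact (f ⁻¹' {z}) := (isClosed_singleton.preimage hf).isCompact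
      have hsub : f ⁻¹' {z} ⊆ f ⁻¹' U := Set.preimage_mono (Set.singleton_subset_iff.2 hzU)
      let S : Set (Set X) := {V | V ∈ B ∧ V ⊆ f ⁻¹' U}
      obtain ⟨F, hFS, hFfin, hF⟩ := hcomp.elim_finite_subcover_image (b := S) (c := id)
        (fun V hV => hB V hV.1) (fun x hx => by
          obtain ⟨V, hV, hxV, hVU⟩ :=
            (TopologicalSpace.isBasis_countableBasis X).exists_subset_of_mem_open
              (hsub hx) (hU.preimage hf)
          exact Set.mem_biUnion (show V ∈ S from ⟨hV, hVU⟩) hxV)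
      simp only [id, ← Set.sUnion_eq_biUnion] at hF
      refine ⟨_, ⟨F, ⟨hFfin, fun V hV => (hFS hV).1⟩, rfl⟩, ?_, ?_⟩
      · rintro ⟨x, hx, hxz⟩
        exact hx (hF hxz)
      · intro w hw
        obtain ⟨x, rfl⟩ := hs w
        by_contra hxU
        refine hw ⟨x, ?_, rfl⟩
        rintro ⟨V, hV, hxV⟩
        exact hxU ((hFS hV).2 hxV)
  refine hbasis.secondCountableTopology (Set.Countable.image ?_ _)
  exact Set.countable_ofPred_finite_subset (TopologicalSpace.countable_countableBasis X)

end Quotient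

/-! ### Distal actions of semigroups -/

section Distal

variable {M : Type*} {X : Type u} {Y : Type v} [Add M]

/-- An action `A` of the additive semigroup `M` by continuous maps of `Y` is distal: no orbit of
a pair of distinct points accumulates at the diagonal. -/
structure IsDistalAction [TopologicalSpace Y] (A : M → Y → Y) : Prop where
  continuous : ∀ g, Continuous (A g)
  map_add : ∀ g h y, A (g + h) y = A g (A h y)
  distal : ∀ x y z, (z, z) ∈ closure (Set.range fun g => (A g x, A g y)) → x = y

namespace IsDistalAction

theorem prodMap [TopologicalSpace X] [TopologicalSpace Y] {A : M → X → X} {B : M → Y → Y}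
    (hA : IsDistalAction A) (hB : IsDistalAction B) :
    IsDistalAction fun g => Prod.map (A g) (B g) where
  continuous g := (hA.continuous g).prodMap (hB.continuous g)
  map_add g h y := by simp only [Prod.map, hA.map_add, hB.map_add]
  distal := by
    rintro ⟨x, x'⟩ ⟨y, y'⟩ ⟨z, z'⟩ h
    refine Prod.ext (hA.distal x y z ?_) (hB.distal x' y' z' ?_)
    · refine map_mem_closure (f := fun p : (X × Y) × (X × Y) => (p.1.1, p.2.1))
        (by fun_prop) h ?_
      rintro _ ⟨g, rfl⟩
      exact ⟨g, rfl⟩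
    · refine map_mem_closure (f := fun p : (X × Y) × (X × Y) => (p.1.2, p.2.2))
        (by fun_prop) h ?_
      rintro _ ⟨g, rfl⟩
      exact ⟨g, rfl⟩

theorem mem_closure_trans [TopologicalSpace Y] {A : M → Y → Y} (hA : IsDistalAction A)
    {x y z : Y} (hy : y ∈ closure (Set.range fun g => A g x))
    (hz : z ∈ closure (Set.range fun g => A g y)) : z ∈ closure (Set.range fun g => A g x) := by
  refine closure_minimal ?_ isClosed_closure hz
  rintro _ ⟨g, rfl⟩
  refine map_mem_closure (hA.continuous g) hy ?_
  rintro _ ⟨h, rfl⟩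
  exact ⟨g + h, hA.map_add g h x⟩

/-- In a distal system on a compact space, orbit closures partition the space. The proof uses an
idempotent of the enveloping semigroup. -/
theorem mem_closure_symm [TopologicalSpace Y] [CompactSpace Y] [T2Space Y] {A : M → Y → Y}
    (hA : IsDistalAction A) {x y : Y} (h : y ∈ closure (Set.range fun g => A g x)) :
    x ∈ closure (Set.range fun g => A g y) := by
  -- The enveloping semigroup. Its elements need not be continuous, so only `p ↦ p ∘ q` is
  -- continuous in general; continuity of `q ↦ A g ∘ q` is what makes `E` closed under composition.
  let E : Set (Y → Y) := closure (Set.range A)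
  have hcomp : ∀ q : Y → Y, Continuous fun p : Y → Y => p ∘ q := fun q =>
    continuous_pi fun z => continuous_apply (q z)
  have hE : ∀ p ∈ E, ∀ q ∈ E, p ∘ q ∈ E := by
    intro p hp q hq
    have hsub : Set.range A ⊆ (fun p : Y → Y => p ∘ q) ⁻¹' E := by
      rintro _ ⟨g, rfl⟩
      refine map_mem_closure (f := fun q : Y → Y => A g ∘ q)
        (continuous_pi fun z => (hA.continuous g).comp (continuous_apply z)) hq ?_
      rintro _ ⟨h, rfl⟩
      exact ⟨g + h, funext (hA.map_add g h)⟩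
    exact closure_minimal hsub (isClosed_closure.preimage (hcomp q)) hp
  have heval : ∀ p ∈ E, ∀ z, p z ∈ closure (Set.range fun g => A g z) := by
    intro p hp z
    refine map_mem_closure (f := fun q : Y → Y => q z) (continuous_apply z) hp ?_
    rintro _ ⟨g, rfl⟩
    exact ⟨g, rfl⟩
  obtain ⟨q, hq, rfl⟩ :=
    exists_mem_closure_range_lift (f := fun p : Y → Y => p x) (continuous_apply x) A h
  let : TopologicalSpace (Function.End Y) := (Pi.topologicalSpace : TopologicalSpace (Y → Y))
  have : T2Space (Function.End Y) := (Pi.t2Space : T2Space (Y → Y))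
  -- With `y = q x`, the idempotent is sought in the left ideal `E ∘ q`, so that it has the form `p
  -- ∘ q` and `p` brings `q x` back to `x`.
  obtain ⟨w, ⟨p, hp, rfl⟩, hw⟩ := exists_idempotent_in_compact_subsemigroup (M := Function.End Y)
    (fun q => hcomp q) ((fun p : Y → Y => p ∘ q) '' E) ⟨_, q, hq, rfl⟩
    (isClosed_closure.isCompact.image (hcomp q)) (by
      rintro _ ⟨a, ha, rfl⟩ _ ⟨b, hb, rfl⟩
      exact ⟨a ∘ q ∘ b, hE _ ha _ (hE _ hq _ hb), rfl⟩)
  have hpq : p (q x) = x := by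
    -- The idempotent sends both `x` and `p (q x)` to `p (q x)`, so this pair accumulates at the
    -- diagonal and distality makes it equal.
    refine (hA.distal x (p (q x)) (p (q x)) ?_).symm
    have hidem : p (q (p (q x))) = p (q x) := congrFun hw x
    have hmem : p ∘ q ∈ E := hE _ hp _ hq
    have := map_mem_closure (f := fun r : Y → Y => (r x, r (p (q x))))
      ((continuous_apply x).prodMk (continuous_apply (p (q x)))) hmem
      (t := Set.range fun g => (A g x, A g (p (q x)))) (by
        rintro _ ⟨g, rfl⟩
        exact ⟨g, rfl⟩)
    simpa [hidem] using this
  have := heval p hp (q x)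
  rwa [hpq] at this

end IsDistalAction

theorem zpow_zpow_apply [TopologicalSpace X] (T : X ≃ₜ X) (m n : ℤ) (x : X) :
    (T ^ m) ((T ^ n) x) = (T ^ (m + n)) x := by
  rw [zpow_add]; rfl

theorem zpow_zero_apply [TopologicalSpace X] (T : X ≃ₜ X) (x : X) :
    (T ^ (0 : ℤ)) x = x := by
  rw [zpow_zero]; rfl

/-- Reparametrizing the powers of `T` by an additive `φ` lets a larger group act on each coordinate
through its own character; `prodMap` then gives distality of the actions on products. -/
theorem IsDistalSystem.isDistalAction [MetricSpace X] {T : X ≃ₜ X} (hT : IsDistalSystem T)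
    (φ : M → ℤ) (hφ : ∀ g h, φ (g + h) = φ g + φ h) :
    IsDistalAction fun g x => (T ^ φ g) x where
  continuous g := (T ^ φ g).continuous
  map_add g h y := by simp only [hφ, zpow_zpow_apply]
  distal x y z h := by
    by_contra hxy
    have hpos := hT x y hxy
    set δ := ⨅ n : ℤ, dist ((T ^ n) x) ((T ^ n) y)
    obtain ⟨_, ⟨g, rfl⟩, hg⟩ := Metric.mem_closure_iff.1 h (δ / 2) (by positivity)
    rw [Prod.dist_eq, max_lt_iff] at hg
    have hle : δ ≤ dist ((T ^ φ g) x) ((T ^ φ g) y) :=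
      ciInf_le ⟨0, by rintro _ ⟨n, rfl⟩; exact dist_nonneg⟩ (φ g)
    have := dist_triangle_left ((T ^ φ g) x) ((T ^ φ g) y) z
    linarith [hg.1, hg.2]

end Distal

/-! ### Parallelograms -/

section Parallelograms

variable {X : Type u} [MetricSpace X] {T : X ≃ₜ X}

theorem parallelograms_flip {x₀ x₁ x₂ x₃ : X} (h : (x₀, x₁, x₂, x₃) ∈ parallelograms T) :
    (x₀, x₂, x₁, x₃) ∈ parallelograms T := by
  refine map_mem_closure (f := fun w : X × X × X × X => (w.1, w.2.2.1, w.2.1, w.2.2.2))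
    (by fun_prop) h ?_
  rintro _ ⟨x, m, n, rfl⟩
  exact ⟨x, n, m, by simp only [add_comm]⟩

theorem parallelograms_symm {x₀ x₁ x₂ x₃ : X} (h : (x₀, x₁, x₂, x₃) ∈ parallelograms T) :
    (x₂, x₃, x₀, x₁) ∈ parallelograms T := by
  refine map_mem_closure (f := fun w : X × X × X × X => (w.2.2.1, w.2.2.2, w.1, w.2.1))
    (by fun_prop) h ?_
  rintro _ ⟨x, m, n, rfl⟩
  refine ⟨(T ^ n) x, m, -n, ?_⟩
  simp only [zpow_zpow_apply, neg_add_cancel, zpow_zero_apply, neg_add_cancel_right]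

theorem parallelograms_swap {x₀ x₁ x₂ x₃ : X} (h : (x₀, x₁, x₂, x₃) ∈ parallelograms T) :
    (x₁, x₀, x₃, x₂) ∈ parallelograms T :=
  parallelograms_flip (parallelograms_symm (parallelograms_flip h))

theorem IsMinimalSystem.mem_closure (hT : IsMinimalSystem T) (x y : X) :
    y ∈ closure (Set.range fun n : ℤ => (T ^ n) x) :=
  hT x y

theorem IsMinimalSystem.mk_zpow_mem_parallelograms (hT : IsMinimalSystem T) (x y : X) (n : ℤ) :
    (x, y, (T ^ n) x, (T ^ n) y) ∈ parallelograms T := by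
  refine map_mem_closure (f := fun z : X => (x, z, (T ^ n) x, (T ^ n) z)) (by fun_prop)
    (hT.mem_closure x y) ?_
  rintro _ ⟨m, rfl⟩
  exact ⟨x, m, n, by simp only [zpow_zpow_apply, add_comm n m]⟩

theorem IsMinimalSystem.parallelograms_refl (hT : IsMinimalSystem T) (x y : X) :
    (x, y, x, y) ∈ parallelograms T := by
  simpa only [zpow_zero_apply] using hT.mk_zpow_mem_parallelograms x y 0

/-- Three vertices can always be completed to a parallelogram. -/
theorem IsMinimalSystem.exists_mem_parallelograms [CompactSpace X] (hT : IsMinimalSystem T)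
    (x₀ x₁ x₂ : X) : ∃ x₃, (x₀, x₁, x₂, x₃) ∈ parallelograms T := by
  have hd : DenseRange (Prod.map (fun m : ℤ => (T ^ m) x₀) (fun n : ℤ => (T ^ n) x₀)) :=
    DenseRange.prodMap (hT x₀) (hT x₀)
  obtain ⟨⟨⟨a, b⟩, c⟩, hc, hab⟩ := exists_mem_closure_range_lift (Z := X × X)
    (f := (Prod.fst : (X × X) × X → X × X)) continuous_fst
    (fun p : ℤ × ℤ => (((T ^ p.1) x₀, (T ^ p.2) x₀), (T ^ (p.1 + p.2)) x₀)) (hd (x₁, x₂))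
  obtain ⟨rfl, rfl⟩ := Prod.mk.inj hab
  refine ⟨c, map_mem_closure (f := fun w : (X × X) × X => (x₀, w.1.1, w.1.2, w.2))
    (by fun_prop) hc ?_⟩
  rintro _ ⟨⟨m, n⟩, rfl⟩
  exact ⟨x₀, m, n, rfl⟩

/-- The action on `X⁴` generated by the diagonal and the two face transformations. -/
def cubeAction (T : X ≃ₜ X) (g : ℤ × ℤ × ℤ) : X × X × X × X → X × X × X × X :=
  Prod.map ⇑(T ^ g.1) (Prod.map ⇑(T ^ (g.1 + g.2.1))
    (Prod.map ⇑(T ^ (g.1 + g.2.2)) ⇑(T ^ (g.1 + g.2.1 + g.2.2))))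

/-- The action on `X⁴` generated by the two face transformations fixing the first vertex. -/
def faceAction (T : X ≃ₜ X) (g : ℤ × ℤ) : X × X × X × X → X × X × X × X :=
  Prod.map ⇑(T ^ (0 : ℤ)) (Prod.map ⇑(T ^ g.1) (Prod.map ⇑(T ^ g.2) ⇑(T ^ (g.1 + g.2))))

/-- The action on `X⁶ = (X²)³` generated by the diagonal transformation, the face transformation
moving the second vertex of each pair, and the maps `T × T` acting on the second and on the
third pair. -/
def prismAction (T : X ≃ₜ X) (g : ℤ × ℤ × ℤ × ℤ) :
    X × X × X × X × X × X → X × X × X × X × X × X :=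
  Prod.map ⇑(T ^ g.1) (Prod.map ⇑(T ^ (g.1 + g.2.1))
    (Prod.map ⇑(T ^ (g.1 + g.2.2.1)) (Prod.map ⇑(T ^ (g.1 + g.2.1 + g.2.2.1))
      (Prod.map ⇑(T ^ (g.1 + g.2.2.2)) ⇑(T ^ (g.1 + g.2.1 + g.2.2.2))))))

theorem IsDistalSystem.isDistalAction_cubeAction (hT : IsDistalSystem T) :
    IsDistalAction (cubeAction T) := by
  have hA := hT.isDistalAction (M := ℤ × ℤ × ℤ)
  refine (hA (fun g => g.1) ?_).prodMap <|
    (hA (fun g => g.1 + g.2.1) ?_).prodMap <|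
    (hA (fun g => g.1 + g.2.2) ?_).prodMap <|
    hA (fun g => g.1 + g.2.1 + g.2.2) ?_ <;>
  · intro g h
    try simp only [Prod.fst_add, Prod.snd_add]
    try ring

theorem IsDistalSystem.isDistalAction_faceAction (hT : IsDistalSystem T) :
    IsDistalAction (faceAction T) := by
  have hA := hT.isDistalAction (M := ℤ × ℤ)
  refine (hA (fun _ => 0) ?_).prodMap <|
    (hA (fun g => g.1) ?_).prodMap <|
    (hA (fun g => g.2) ?_).prodMap <|
    hA (fun g => g.1 + g.2) ?_ <;>
  · intro g h
    try simp only [Prod.fst_add, Prod.snd_add]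
    try ring

theorem IsDistalSystem.isDistalAction_prismAction (hT : IsDistalSystem T) :
    IsDistalAction (prismAction T) := by
  have hA := hT.isDistalAction (M := ℤ × ℤ × ℤ × ℤ)
  refine (hA (fun g => g.1) ?_).prodMap <|
    (hA (fun g => g.1 + g.2.1) ?_).prodMap <|
    (hA (fun g => g.1 + g.2.2.1) ?_).prodMap <|
    (hA (fun g => g.1 + g.2.1 + g.2.2.1) ?_).prodMap <|
    (hA (fun g => g.1 + g.2.2.2) ?_).prodMap <|
    hA (fun g => g.1 + g.2.1 + g.2.2.2) ?_ <;>
  · intro g h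
    try simp only [Prod.fst_add, Prod.snd_add]
    try ring

theorem IsDistalSystem.isDistalAction_prod (hT : IsDistalSystem T) :
    IsDistalAction fun (n : ℤ) => Prod.map (T ^ n) (T ^ n) :=
  (hT.isDistalAction _ fun _ _ => rfl).prodMap (hT.isDistalAction _ fun _ _ => rfl)

theorem cubeAction_mem_parallelograms (g : ℤ × ℤ × ℤ) {w : X × X × X × X}
    (hw : w ∈ parallelograms T) : cubeAction T g w ∈ parallelograms T := by
  refine map_mem_closure (f := cubeAction T g) (by unfold cubeAction; fun_prop) hw ?_
  rintro _ ⟨x, m, n, rfl⟩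
  obtain ⟨k, m', n'⟩ := g
  refine ⟨(T ^ k) x, m' + m, n' + n, ?_⟩
  simp only [cubeAction, Prod.map, zpow_zpow_apply, Prod.mk.injEq]
  refine ⟨trivial, ?_, ?_, ?_⟩ <;> congr 2 <;> ring

theorem IsMinimalSystem.mem_closure_cubeAction_diag (hT : IsMinimalSystem T) (x : X)
    {w : X × X × X × X} (hw : w ∈ parallelograms T) :
    w ∈ closure (Set.range fun g => cubeAction T g (x, x, x, x)) := by
  refine closure_minimal ?_ isClosed_closure hw
  rintro _ ⟨y, m, n, rfl⟩
  refine map_mem_closure (f := fun z : X => (z, (T ^ m) z, (T ^ n) z, (T ^ (m + n)) z))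
    (by fun_prop) (hT.mem_closure x y) ?_
  rintro _ ⟨k, rfl⟩
  refine ⟨(k, m, n), ?_⟩
  simp only [cubeAction, Prod.map, zpow_zpow_apply, Prod.mk.injEq]
  refine ⟨trivial, ?_, ?_, ?_⟩ <;> congr 2 <;> ring

theorem diag_mem_closure_cubeAction [CompactSpace X] (hmin : IsMinimalSystem T)
    (hdist : IsDistalSystem T) (x : X) {w : X × X × X × X} (hw : w ∈ parallelograms T) :
    (x, x, x, x) ∈ closure (Set.range fun g => cubeAction T g w) :=
  hdist.isDistalAction_cubeAction.mem_closure_symm (hmin.mem_closure_cubeAction_diag x hw)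

theorem IsMinimalSystem.diag_mem_parallelograms (hT : IsMinimalSystem T) (x : X) :
    (x, x, x, x) ∈ parallelograms T := hT.parallelograms_refl x x

/-- The prism orbit closure of the six points contains a diagonal point. Distality reverses this,
and projecting to the first and third pairs exhibits a limit of parallelograms. -/
theorem parallelograms_trans [CompactSpace X] (hmin : IsMinimalSystem T)
    (hdist : IsDistalSystem T) {x₀ x₁ x₂ x₃ x₄ x₅ : X}
    (h : (x₀, x₁, x₂, x₃) ∈ parallelograms T) (h' : (x₂, x₃, x₄, x₅) ∈ parallelograms T) :
    (x₀, x₁, x₄, x₅) ∈ parallelograms T := by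
  have hA := hdist.isDistalAction_prismAction
  set w := (x₀, x₁, x₂, x₃, x₄, x₅) with hw
  -- Move the first two pairs to the diagonal, translating the last two in parallel.
  obtain ⟨⟨a, b, c, d, y, z⟩, hw', hpr⟩ := exists_mem_closure_range_lift (Z := X × X × X × X)
    (f := fun v : X × X × X × X × X × X => (v.1, v.2.1, v.2.2.1, v.2.2.2.1)) (by fun_prop)
    -- The repeated `g.2.2` moves the third pair exactly as the second, so the two stay parallel.
    (fun g : ℤ × ℤ × ℤ => prismAction T (g.1, g.2.1, g.2.2, g.2.2) w)
    (diag_mem_closure_cubeAction hmin hdist x₀ h)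
  simp only [Prod.mk.injEq] at hpr
  rw [hpr.1, hpr.2.1, hpr.2.2.1, hpr.2.2.2] at hw'
  have hyz : (x₀, x₀, y, z) ∈ parallelograms T := by
    refine closure_minimal ?_ (isClosed_closure.preimage (f := fun v : X × X × X × X × X × X =>
      (v.2.2.1, v.2.2.2.1, v.2.2.2.2.1, v.2.2.2.2.2)) (by fun_prop)) hw'
    rintro _ ⟨⟨k, m, n⟩, rfl⟩
    have := cubeAction_mem_parallelograms (k + n, m, 0) h'
    simp only [cubeAction, Prod.map, add_zero, add_right_comm k n m] at this
    exact this
  have hw₁ : (x₀, x₀, x₀, x₀, y, z) ∈ closure (Set.range fun g => prismAction T g w) := by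
    refine closure_mono ?_ hw'
    rintro _ ⟨g, rfl⟩
    exact ⟨_, rfl⟩
  -- Move the last pair to the diagonal, keeping the first two pairs equal.
  have hw₂ : (x₀, x₀, x₀, x₀, x₀, x₀) ∈
      closure (Set.range fun g => prismAction T g (x₀, x₀, x₀, x₀, y, z)) := by
    refine map_mem_closure (f := fun v : X × X × X × X =>
      (v.1, v.2.1, v.1, v.2.1, v.2.2.1, v.2.2.2)) (by fun_prop)
      (diag_mem_closure_cubeAction hmin hdist x₀ hyz) ?_
    rintro _ ⟨⟨k, m, n⟩, rfl⟩
    exact ⟨(k, m, 0, n), by simp only [cubeAction, prismAction, Prod.map, add_zero]⟩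
  have hw₃ := hA.mem_closure_symm (hA.mem_closure_trans hw₁ hw₂)
  refine closure_minimal ?_ (isClosed_closure.preimage (f := fun v : X × X × X × X × X × X =>
    (v.1, v.2.1, v.2.2.2.2.1, v.2.2.2.2.2)) (by fun_prop)) hw₃
  rintro _ ⟨⟨k, m, n, l⟩, rfl⟩
  exact cubeAction_mem_parallelograms (k, m, l) (hmin.diag_mem_parallelograms x₀)

/-- For some pair `(a, b)`, the orbit closure of `(a, b)` under `T × T` is a whole class of the
parallelogram relation. -/
theorem exists_generic_pair [CompactSpace X] [Nonempty X] (T : X ≃ₜ X) :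
    ∃ a b : X, ∀ c d, (a, b, c, d) ∈ parallelograms T →
      (c, d) ∈ closure (Set.range fun n : ℤ => Prod.map (T ^ n) (T ^ n) (a, b)) := by
  let B := TopologicalSpace.countableBasis (X × X)
  have : Countable B := (TopologicalSpace.countable_countableBasis (X × X)).to_subtype
  -- `D U` is the open set of pairs whose orbit meets `U`. Its frontier is nowhere dense, so by
  -- Baire some pair avoids the frontiers for all basic `U`.
  let D : Set (X × X) → Set (X × X) := fun U => ⋃ n : ℤ, Prod.map (T ^ n) (T ^ n) ⁻¹' U
  have hD : ∀ U ∈ B, IsOpen (D U) := fun U hU => isOpen_iUnion fun n =>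
    (TopologicalSpace.isOpen_of_mem_countableBasis hU).preimage (by fun_prop)
  obtain ⟨⟨a, b⟩, hab⟩ : (⋂ U : B, (frontier (D U))ᶜ).Nonempty :=
    (dense_iInter_of_isOpen (fun U : B => isClosed_frontier.isOpen_compl) fun U =>
      interior_eq_empty_iff_dense_compl.1 (interior_frontier (hD U U.2).isClosed_compl ▸ by
        rw [frontier_compl])).nonempty
  refine ⟨a, b, fun c d hcd => ?_⟩
  rw [(TopologicalSpace.isBasis_countableBasis (X × X)).mem_closure_iff]
  intro U hU hcdU
  have habU : (a, b) ∉ frontier (D U) := Set.mem_iInter.1 hab ⟨U, hU⟩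
  by_contra hempty
  have hnot : (a, b) ∉ D U := by
    intro h
    obtain ⟨n, hn⟩ := Set.mem_iUnion.1 h
    exact hempty ⟨_, hn, n, rfl⟩
  have hnot' : (a, b) ∉ closure (D U) := fun h =>
    habU ⟨h, fun h' => hnot (interior_subset h')⟩
  let N : Set (X × X × X × X) :=
    {w | (w.1, w.2.1) ∈ (closure (D U))ᶜ ∧ (w.2.2.1, w.2.2.2) ∈ U}
  have hN : IsOpen N := (isClosed_closure.isOpen_compl.preimage (by fun_prop)).inter
    ((TopologicalSpace.isOpen_of_mem_countableBasis hU).preimage (by fun_prop))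
  obtain ⟨_, ⟨hw₁, hw₂⟩, ⟨x, m, n, rfl⟩⟩ := mem_closure_iff.1 hcd N hN ⟨hnot', hcdU⟩
  -- In a genuine parallelogram the second pair is the image of the first under `(T × T)ⁿ`, so if it
  -- lies in `U` then the first lies in `D U`.
  refine hw₁ (subset_closure (Set.mem_iUnion.2 ⟨n, ?_⟩))
  simpa only [Set.mem_preimage, Prod.map, zpow_zpow_apply, add_comm n m] using hw₂

/-- Genericity passes to every limit of the orbit of a generic pair: the limit is parallel to that
pair and, by distality, has the same orbit closure. Minimality lets the first coordinate of the
limit be prescribed. -/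
theorem exists_generic_partner [CompactSpace X] [Nonempty X] (hmin : IsMinimalSystem T)
    (hdist : IsDistalSystem T) (x : X) :
    ∃ y : X, ∀ c d, (x, y, c, d) ∈ parallelograms T →
      (c, d) ∈ closure (Set.range fun n : ℤ => Prod.map (T ^ n) (T ^ n) (x, y)) := by
  have hA := hdist.isDistalAction_prod
  obtain ⟨a, b, hab⟩ := exists_generic_pair T
  obtain ⟨⟨x, y⟩, hxy, rfl⟩ := exists_mem_closure_range_lift (f := (Prod.fst : X × X → X))
    continuous_fst (fun n : ℤ => Prod.map (T ^ n) (T ^ n) (a, b)) (hmin.mem_closure a x)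
  refine ⟨y, fun c d hcd => hA.mem_closure_trans (hA.mem_closure_symm hxy) (hab c d ?_)⟩
  refine parallelograms_trans hmin hdist ?_ hcd
  refine closure_minimal ?_ (isClosed_closure.preimage (f := fun v : X × X => (a, b, v.1, v.2))
    (by fun_prop)) hxy
  rintro _ ⟨n, rfl⟩
  exact hmin.mk_zpow_mem_parallelograms a b n

/-- The parallelograms with first vertex `x` form the orbit closure of `(x, x, x, x)` under the
face transformations fixing that vertex. -/
theorem mem_closure_faceAction_diag [CompactSpace X] [Nonempty X] (hmin : IsMinimalSystem T)
    (hdist : IsDistalSystem T) {x x₁ x₂ x₃ : X} (h : (x, x₁, x₂, x₃) ∈ parallelograms T) :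
    (x, x₁, x₂, x₃) ∈ closure (Set.range fun g => faceAction T g (x, x, x, x)) := by
  have hA := hdist.isDistalAction_faceAction
  obtain ⟨y, hy⟩ := exists_generic_partner hmin hdist x
  obtain ⟨⟨y, z⟩, hyz, rfl⟩ := exists_mem_closure_range_lift (f := (Prod.fst : X × X → X))
    continuous_fst (fun n : ℤ => Prod.map (T ^ n) (T ^ n) (x₁, x₃)) (hmin.mem_closure x₁ y)
  have hz : (x, y, x₂, z) ∈ parallelograms T := by
    refine closure_minimal ?_ (isClosed_closure.preimage
      (f := fun v : X × X => (x, v.1, x₂, v.2)) (by fun_prop)) hyz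
    rintro _ ⟨n, rfl⟩
    have := cubeAction_mem_parallelograms (0, n, 0) h
    simp only [cubeAction, Prod.map, zero_add, add_zero, zpow_zero_apply] at this
    exact this
  have hback : (x, x₁, x₂, x₃) ∈ closure (Set.range fun g => faceAction T g (x, y, x₂, z)) := by
    refine hA.mem_closure_symm (map_mem_closure (f := fun v : X × X => (x, v.1, x₂, v.2))
      (by fun_prop) hyz ?_)
    rintro _ ⟨n, rfl⟩
    exact ⟨(n, 0), by simp only [faceAction, Prod.map, add_zero, zpow_zero_apply]⟩
  -- The path is `(x, x, x, x) → (x, y, x, y) → (x, y, x₂, z) → (x, x₁, x₂, x₃)`; genericity of `(x,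
  -- y)` gives the middle arrow, distality the last.
  refine hA.mem_closure_trans (hA.mem_closure_trans (y := (x, y, x, y)) ?_ ?_) hback
  · refine map_mem_closure (f := fun v : X => (x, v, x, v)) (by fun_prop)
      (hmin.mem_closure x y) ?_
    rintro _ ⟨n, rfl⟩
    exact ⟨(n, 0), by simp only [faceAction, Prod.map, add_zero, zpow_zero_apply]⟩
  · refine map_mem_closure (f := fun v : X × X => (x, y, v.1, v.2)) (by fun_prop)
      (hy x₂ z hz) ?_
    rintro _ ⟨n, rfl⟩
    exact ⟨(0, n), by simp only [faceAction, Prod.map, zero_add, zpow_zero_apply]⟩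

theorem mem_parallelograms_iff_exists_seq [CompactSpace X] [Nonempty X]
    (hmin : IsMinimalSystem T) (hdist : IsDistalSystem T) (x₀ x₁ x₂ x₃ : X) :
    (x₀, x₁, x₂, x₃) ∈ parallelograms T ↔
      ∃ m n : ℕ → ℤ,
        Tendsto (fun i => (T ^ m i) x₀) atTop (𝓝 x₁) ∧
        Tendsto (fun i => (T ^ n i) x₀) atTop (𝓝 x₂) ∧
        Tendsto (fun i => (T ^ (m i + n i)) x₀) atTop (𝓝 x₃) := by
  constructor
  · intro h
    obtain ⟨w, hw, hlim⟩ :=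
      mem_closure_iff_seq_limit.1 (mem_closure_faceAction_diag hmin hdist h)
    choose g hg using hw
    obtain rfl : (fun i => faceAction T (g i) (x₀, x₀, x₀, x₀)) = w := funext hg
    refine ⟨fun i => (g i).1, fun i => (g i).2, ?_, ?_, ?_⟩
    · exact ((continuous_fst.comp continuous_snd).tendsto _).comp hlim
    · exact ((continuous_fst.comp (continuous_snd.comp continuous_snd)).tendsto _).comp hlim
    · exact ((continuous_snd.comp (continuous_snd.comp continuous_snd)).tendsto _).comp hlim
  · rintro ⟨m, n, h₁, h₂, h₃⟩
    exact mem_closure_of_tendsto (tendsto_const_nhds.prodMk_nhds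
      (h₁.prodMk_nhds (h₂.prodMk_nhds h₃)))
      (Eventually.of_forall fun i => ⟨x₀, m i, n i, rfl⟩)

end Parallelograms

/-! ### Equicontinuous factors -/

section Factors

variable {X : Type u} [MetricSpace X] {T : X ≃ₜ X}

theorem zpow_apply_of_succ {Y : Type v} [TopologicalSpace Y] (R : Y ≃ₜ Y) (f : ℤ → Y)
    (hf : ∀ n, f (n + 1) = R (f n)) (n : ℤ) : f n = (R ^ n) (f 0) := by
  have hR : ∀ (n : ℤ) (y : Y), (R ^ (n + 1)) y = R ((R ^ n) y) := fun n y => by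
    rw [add_comm, zpow_add, zpow_one]; rfl
  induction n using Int.induction_on with
  | zero => rw [zpow_zero_apply]
  | succ n ih => rw [hf, ih, hR]
  | pred n ih =>
    apply R.injective
    rw [← hf, ← hR, sub_add_cancel, ih]

theorem IsFactorMap.map_zpow {Y : Type v} [TopologicalSpace Y] {R : Y ≃ₜ Y} {p : X → Y}
    (hp : IsFactorMap T R p) (n : ℤ) (x : X) : p ((T ^ n) x) = (R ^ n) (p x) := by
  have := zpow_apply_of_succ R (fun n => p ((T ^ n) x)) (fun n => by
    rw [← hp.semiconj, add_comm, zpow_add, zpow_one]; rfl) n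
  simpa only [zpow_zero_apply] using this

theorem mulLeft_zpow_apply {Z : Type v} [CommGroup Z] [TopologicalSpace Z] [IsTopologicalGroup Z]
    (α : Z) (n : ℤ) (z : Z) : ((Homeomorph.mulLeft α) ^ n) z = α ^ n * z := by
  have := zpow_apply_of_succ (Homeomorph.mulLeft α) (fun n => α ^ n * z) (fun n => by
    simp only [Homeomorph.coe_mulLeft, add_comm n 1, zpow_add, zpow_one, mul_assoc]) n
  simpa only [zpow_zero, one_mul] using this.symm

/-- Rotations of compact groups are equicontinuous. -/
theorem isEquicontinuousSystem_mulLeft {Z : Type v} [CommGroup Z] [MetricSpace Z] [CompactSpace Z]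
    [IsTopologicalGroup Z] (α : Z) : IsEquicontinuousSystem (Homeomorph.mulLeft α) := by
  have hu : UniformContinuous fun p : Z × Z => p.1 * p.2 :=
    CompactSpace.uniformContinuous_of_continuous continuous_mul
  rw [IsEquicontinuousSystem, Metric.uniformEquicontinuous_iff]
  intro ε hε
  obtain ⟨δ, hδ, h⟩ := Metric.uniformContinuous_iff.1 hu ε hε
  refine ⟨δ, hδ, fun x y hxy n => ?_⟩
  rw [mulLeft_zpow_apply, mulLeft_zpow_apply]
  exact h (a := (α ^ n, x)) (b := (α ^ n, y)) (by simpa [Prod.dist_eq] using hxy)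

/-- An equicontinuous factor identifies `x` and `y` as soon as `(w, x, w, y)` is a
parallelogram. -/
theorem IsFactorMap.eq_of_mem_parallelograms {Y : Type v} [MetricSpace Y] {R : Y ≃ₜ Y} {p : X → Y}
    (hp : IsFactorMap T R p) (hR : IsEquicontinuousSystem R) {w x y : X}
    (h : (w, x, w, y) ∈ parallelograms T) : p x = p y := by
  refine eq_of_forall_dist_le fun ε hε => ?_
  obtain ⟨δ, hδ, hRδ⟩ := Metric.uniformEquicontinuous_iff.1 hR (ε / 3) (by positivity)
  have hc := hp.continuous
  let N : Set (X × X × X × X) := {v | dist (p v.1) (p w) < δ / 2 ∧ dist (p v.2.1) (p x) < ε / 3 ∧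
    dist (p v.2.2.1) (p w) < δ / 2 ∧ dist (p v.2.2.2) (p y) < ε / 3}
  have hN : IsOpen N := by
    refine IsOpen.and ?_ (IsOpen.and ?_ (IsOpen.and ?_ ?_)) <;>
    exact isOpen_lt (by fun_prop) continuous_const
  obtain ⟨_, ⟨h₀, h₁, h₂, h₃⟩, ⟨a, m, n, rfl⟩⟩ := mem_closure_iff.1 h N hN
    ⟨by simpa using hδ, by simpa using hε, by simpa using hδ, by simpa using hε⟩
  -- The first and third vertices both project near `p w`; equicontinuity keeps their images close
  -- after applying `Rᵐ`, which yields the second and fourth vertices.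
  have hclose := hRδ (p a) (p ((T ^ n) a))
    (by linarith [dist_triangle_right (p a) (p ((T ^ n) a)) (p w)]) m
  rw [← hp.map_zpow, ← hp.map_zpow, zpow_zpow_apply] at hclose
  linarith [dist_triangle4 (p x) (p ((T ^ m) a)) (p ((T ^ (m + n)) a)) (p y),
    dist_comm (p x) (p ((T ^ m) a))]

/-- Factor maps onto rotations send parallelograms to parallelograms. -/
theorem IsFactorMap.mul_eq_one_of_mem_parallelograms {Z : Type v} [CommGroup Z] [TopologicalSpace Z]
    [T1Space Z] [IsTopologicalGroup Z] {α : Z} {π : X → Z}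
    (hπ : IsFactorMap T (Homeomorph.mulLeft α) π) {x₀ x₁ x₂ x₃ : X}
    (h : (x₀, x₁, x₂, x₃) ∈ parallelograms T) : π x₀ * (π x₁)⁻¹ * (π x₂)⁻¹ * π x₃ = 1 := by
  have hc := hπ.continuous
  refine closure_minimal ?_ ((isClosed_singleton (x := (1 : Z))).preimage
    (f := fun w : X × X × X × X => π w.1 * (π w.2.1)⁻¹ * (π w.2.2.1)⁻¹ * π w.2.2.2)
    (by fun_prop)) h
  rintro _ ⟨x, m, n, rfl⟩
  simp only [Set.mem_preimage, hπ.map_zpow, mulLeft_zpow_apply, Set.mem_singleton_iff]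
  rw [zpow_add]
  generalize α ^ m = b, α ^ n = c, π x = a
  rw [mul_inv_rev b a, mul_inv_cancel_left, ← mul_inv_rev, inv_mul_eq_one, mul_assoc b,
    mul_comm b]

end Factors

/-! ### The group of parallelogram classes -/

section Group

variable {X : Type u} [MetricSpace X] [CompactSpace X] {T : X ≃ₜ X}

/-- `x` and `y` are identified when `(e, x, e, y)` is a parallelogram. -/
def parallelogramSetoid (hmin : IsMinimalSystem T) (hdist : IsDistalSystem T) (e : X) :
    Setoid X where
  r x y := (e, x, e, y) ∈ parallelograms T
  iseqv :=
    { refl := fun x => hmin.parallelograms_refl e x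
      symm := parallelograms_symm
      trans := parallelograms_trans hmin hdist }

/-- All diagonal pairs are parallel, so the base point `e` is immaterial: `(x₂, x₃, x₂, y)` is also
a parallelogram. -/
theorem mem_parallelograms_congr_right (hmin : IsMinimalSystem T) (hdist : IsDistalSystem T)
    {e x₀ x₁ x₂ x₃ y : X} (h : (x₀, x₁, x₂, x₃) ∈ parallelograms T)
    (hy : (e, x₃, e, y) ∈ parallelograms T) : (x₀, x₁, x₂, y) ∈ parallelograms T := by
  have h₁ : (x₂, x₂, x₃, y) ∈ parallelograms T := parallelograms_trans hmin hdist
    (parallelograms_flip (hmin.parallelograms_refl x₂ e)) (parallelograms_flip hy)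
  exact parallelograms_trans hmin hdist h (parallelograms_flip h₁)

/-- The fourth vertex of a parallelogram is determined up to equivalence. -/
theorem parallelograms_unique (hmin : IsMinimalSystem T) (hdist : IsDistalSystem T)
    {x₀ x₁ x₂ x₃ y : X} (e : X) (h : (x₀, x₁, x₂, x₃) ∈ parallelograms T)
    (h' : (x₀, x₁, x₂, y) ∈ parallelograms T) : (e, x₃, e, y) ∈ parallelograms T := by
  have h₁ : (x₂, x₃, x₂, y) ∈ parallelograms T :=
    parallelograms_trans hmin hdist (parallelograms_symm h) h'
  have h₂ : (e, e, x₂, x₂) ∈ parallelograms T :=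
    parallelograms_flip (hmin.parallelograms_refl e x₂)
  exact parallelograms_flip (parallelograms_trans hmin hdist h₂ (parallelograms_flip h₁))

variable (hmin : IsMinimalSystem T) (hdist : IsDistalSystem T) (e : X)

theorem parallelogramSetoid_mk_eq_iff {x y : X} :
    Quotient.mk (parallelogramSetoid hmin hdist e) x = Quotient.mk _ y ↔
      (e, x, e, y) ∈ parallelograms T :=
  Quotient.eq

/-- The product of the classes of `x` and `y` is the class of the fourth vertex of a parallelogram
`(e, x, y, z)`. -/
noncomputable def parallelogramMul :
    Quotient (parallelogramSetoid hmin hdist e) → Quotient (parallelogramSetoid hmin hdist e) →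
      Quotient (parallelogramSetoid hmin hdist e) :=
  Quotient.map₂ (fun x y => (hmin.exists_mem_parallelograms e x y).choose) (by
    intro x x' hx y y' hy
    have h := (hmin.exists_mem_parallelograms e x y).choose_spec
    have h' := (hmin.exists_mem_parallelograms e x' y').choose_spec
    refine parallelograms_unique hmin hdist e (x₀ := e) (x₁ := x) (x₂ := y) h ?_
    refine parallelograms_flip (parallelograms_trans hmin hdist hy (parallelograms_flip ?_))
    exact parallelograms_trans hmin hdist hx h')

theorem parallelogramMul_eq_iff {x y z : X} :
    parallelogramMul hmin hdist e (Quotient.mk _ x) (Quotient.mk _ y) = Quotient.mk _ z ↔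
      (e, x, y, z) ∈ parallelograms T := by
  have h := (hmin.exists_mem_parallelograms e x y).choose_spec
  change Quotient.mk _ ((hmin.exists_mem_parallelograms e x y).choose) = Quotient.mk _ z ↔ _
  rw [parallelogramSetoid_mk_eq_iff]
  exact ⟨fun hz => mem_parallelograms_congr_right hmin hdist h hz,
    fun hz => parallelograms_unique hmin hdist e h hz⟩

theorem parallelogramMul_assoc (a b c : Quotient (parallelogramSetoid hmin hdist e)) :
    parallelogramMul hmin hdist e (parallelogramMul hmin hdist e a b) c =
      parallelogramMul hmin hdist e a (parallelogramMul hmin hdist e b c) := by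
  induction a using Quotient.inductionOn with | _ x
  induction b using Quotient.inductionOn with | _ y
  induction c using Quotient.inductionOn with | _ z
  obtain ⟨r, hr⟩ := hmin.exists_mem_parallelograms e x y
  obtain ⟨t, ht⟩ := hmin.exists_mem_parallelograms e y z
  obtain ⟨s, hs⟩ := hmin.exists_mem_parallelograms e x t
  rw [(parallelogramMul_eq_iff hmin hdist e).2 hr, (parallelogramMul_eq_iff hmin hdist e).2 ht,
    (parallelogramMul_eq_iff hmin hdist e).2 hs, parallelogramMul_eq_iff]
  have h₁ : (y, r, t, s) ∈ parallelograms T :=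
    parallelograms_trans hmin hdist (parallelograms_symm hr) hs
  exact parallelograms_flip (parallelograms_trans hmin hdist (parallelograms_flip ht)
    (parallelograms_flip h₁))

theorem parallelogramMul_comm (a b : Quotient (parallelogramSetoid hmin hdist e)) :
    parallelogramMul hmin hdist e a b = parallelogramMul hmin hdist e b a := by
  induction a using Quotient.inductionOn with | _ x
  induction b using Quotient.inductionOn with | _ y
  obtain ⟨z, hz⟩ := hmin.exists_mem_parallelograms e y x
  rw [(parallelogramMul_eq_iff hmin hdist e).2 hz, parallelogramMul_eq_iff]
  exact parallelograms_flip hz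

theorem parallelogramMul_one (a : Quotient (parallelogramSetoid hmin hdist e)) :
    parallelogramMul hmin hdist e a (Quotient.mk _ e) = a := by
  induction a using Quotient.inductionOn with | _ x
  exact (parallelogramMul_eq_iff hmin hdist e).2 (hmin.parallelograms_refl e x)

theorem exists_parallelogramMul_eq_one (a : Quotient (parallelogramSetoid hmin hdist e)) :
    ∃ b, parallelogramMul hmin hdist e b a = Quotient.mk _ e := by
  induction a using Quotient.inductionOn with | _ x
  obtain ⟨y, hy⟩ := hmin.exists_mem_parallelograms x e e
  exact ⟨Quotient.mk _ y, (parallelogramMul_eq_iff hmin hdist e).2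
    (parallelograms_flip (parallelograms_swap hy))⟩

/-- The quotient of `X` by `parallelogramSetoid` is an abelian group with neutral element the class
of `e`. -/
noncomputable abbrev parallelogramGroup :
    CommGroup (Quotient (parallelogramSetoid hmin hdist e)) where
  mul := parallelogramMul hmin hdist e
  mul_assoc := parallelogramMul_assoc hmin hdist e
  one := Quotient.mk _ e
  one_mul a := (parallelogramMul_comm hmin hdist e _ a).trans (parallelogramMul_one hmin hdist e a)
  mul_one := parallelogramMul_one hmin hdist e
  inv a := (exists_parallelogramMul_eq_one hmin hdist e a).choose
  inv_mul_cancel a := (exists_parallelogramMul_eq_one hmin hdist e a).choose_spec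
  mul_comm := parallelogramMul_comm hmin hdist e

theorem isClosed_parallelogramSetoid :
    IsClosed {p : X × X | parallelogramSetoid hmin hdist e p.1 p.2} :=
  isClosed_closure.preimage (f := fun p : X × X => (e, p.1, e, p.2)) (by fun_prop)

theorem t2Space_parallelogramGroup : T2Space (Quotient (parallelogramSetoid hmin hdist e)) :=
  t2Space_of_isClosedMap continuous_quotient_mk'
    (isClosedMap_quotient_mk _ (isClosed_parallelogramSetoid hmin hdist e)) Quotient.mk_surjective

theorem metrizableSpace_parallelogramGroup :
    TopologicalSpace.MetrizableSpace (Quotient (parallelogramSetoid hmin hdist e)) := by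
  have := t2Space_parallelogramGroup hmin hdist e
  have := secondCountableTopology_of_isClosedMap continuous_quotient_mk'
    (isClosedMap_quotient_mk _ (isClosed_parallelogramSetoid hmin hdist e)) Quotient.mk_surjective
  exact TopologicalSpace.metrizableSpace_of_t3_secondCountable _

theorem isTopologicalGroup_parallelogramGroup :
    @IsTopologicalGroup (Quotient (parallelogramSetoid hmin hdist e)) _
      (parallelogramGroup hmin hdist e).toGroup := by
  let := parallelogramGroup hmin hdist e
  have := t2Space_parallelogramGroup hmin hdist e
  have hmk : Continuous (Quotient.mk (parallelogramSetoid hmin hdist e)) := continuous_quotient_mk'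
  have hmul : ∀ {x y z : X}, (Quotient.mk _ x * Quotient.mk _ y :
      Quotient (parallelogramSetoid hmin hdist e)) = Quotient.mk _ z ↔
      (e, x, y, z) ∈ parallelograms T := parallelogramMul_eq_iff hmin hdist e
  refine { continuous_mul := ?_, continuous_inv := ?_ }
  · refine continuous_iff_isClosed.2 fun C hC => ?_
    -- Representatives cannot be multiplied continuously in `X`, so the preimage of `C` is obtained
    -- as the image of a compact set of parallelograms.
    let K : Set (X × X × X) :=
      {p | (e, p.1, p.2.1, p.2.2) ∈ parallelograms T ∧ Quotient.mk _ p.2.2 ∈ C}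
    have hK : IsClosed K := (isClosed_closure.preimage (by fun_prop)).inter
      (hC.preimage (by fun_prop))
    convert (hK.isCompact.image (f := fun p : X × X × X =>
      (Quotient.mk (parallelogramSetoid hmin hdist e) p.1,
        Quotient.mk (parallelogramSetoid hmin hdist e) p.2.1)) (by fun_prop)).isClosed using 1
    ext ⟨a, b⟩
    constructor
    · induction a using Quotient.inductionOn with | _ x
      induction b using Quotient.inductionOn with | _ y
      intro hab
      obtain ⟨z, hz⟩ := hmin.exists_mem_parallelograms e x y
      refine ⟨(x, y, z), ⟨hz, ?_⟩, rfl⟩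
      rw [← hmul.2 hz]
      exact hab
    · rintro ⟨⟨x, y, z⟩, ⟨hz, hzC⟩, hxy⟩
      rw [← hmul.2 hz] at hzC
      obtain ⟨rfl, rfl⟩ := Prod.mk.inj hxy
      exact hzC
  · refine continuous_iff_isClosed.2 fun C hC => ?_
    let K : Set (X × X) := {p | (e, p.1, p.2, e) ∈ parallelograms T ∧ Quotient.mk _ p.2 ∈ C}
    have hK : IsClosed K := (isClosed_closure.preimage (by fun_prop)).inter
      (hC.preimage (by fun_prop))
    convert (hK.isCompact.image (f := fun p : X × X =>
      Quotient.mk (parallelogramSetoid hmin hdist e) p.1) (by fun_prop)).isClosed using 1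
    have hinv : ∀ {x y : X}, (e, x, y, e) ∈ parallelograms T ↔
        (Quotient.mk (parallelogramSetoid hmin hdist e) x)⁻¹ = Quotient.mk _ y := fun {x y} => by
      rw [← hmul, inv_eq_iff_mul_eq_one]
      rfl
    ext a
    constructor
    · induction a using Quotient.inductionOn with | _ x
      intro hx
      obtain ⟨y, hy⟩ := Quotient.exists_rep (Quotient.mk (parallelogramSetoid hmin hdist e) x)⁻¹
      exact ⟨(x, y), ⟨hinv.2 hy.symm, by rw [hy]; exact hx⟩, rfl⟩
    · rintro ⟨⟨x, y⟩, ⟨hxy, hy⟩, rfl⟩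
      rw [← hinv.1 hxy] at hy
      exact hy

/-- A minimal distal system has a maximal equicontinuous factor which is a rotation and whose
fibres are given by the parallelogram relation. -/
theorem exists_isMaximalEquicontinuousFactor (hmin : IsMinimalSystem T)
    (hdist : IsDistalSystem T) (e : X) :
    ∃ (Z : Type u) (_ : CommGroup Z) (_ : MetricSpace Z) (_ : CompactSpace Z)
      (_ : IsTopologicalGroup Z) (α : Z) (π : X → Z),
      IsMaximalEquicontinuousFactor T (Homeomorph.mulLeft α) π ∧
        ∀ x y, π x = π y → (e, x, e, y) ∈ parallelograms T := by
  let Z := Quotient (parallelogramSetoid hmin hdist e)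
  have := metrizableSpace_parallelogramGroup hmin hdist e
  let hG : CommGroup Z := parallelogramGroup hmin hdist e
  have hZ := isTopologicalGroup_parallelogramGroup hmin hdist e
  let hM : MetricSpace Z := TopologicalSpace.metrizableSpaceMetric Z
  have hmk : Continuous (Quotient.mk (parallelogramSetoid hmin hdist e)) := continuous_quotient_mk'
  have hsemi : ∀ x, (Quotient.mk _ (T x) : Z) = Quotient.mk _ (T e) * Quotient.mk _ x := fun x => by
    have := parallelograms_flip (hmin.mk_zpow_mem_parallelograms e x 1)
    rw [zpow_one] at this
    exact ((parallelogramMul_eq_iff hmin hdist e).2 this).symm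
  refine ⟨Z, hG, hM, Quotient.compactSpace, hZ, Quotient.mk _ (T e), Quotient.mk _, ?_,
    fun x y => (parallelogramSetoid_mk_eq_iff hmin hdist e).1⟩
  refine ⟨⟨hmk, Quotient.mk_surjective, hsemi⟩, isEquicontinuousSystem_mulLeft _, ?_⟩
  intro Y _ _ R p hp hR
  have hlift : ∀ x y, parallelogramSetoid hmin hdist e x y → p x = p y := fun x y h =>
    hp.eq_of_mem_parallelograms hR h
  refine ⟨Quotient.lift p hlift, ⟨hp.continuous.quotient_lift hlift, ?_, ?_⟩, fun x => rfl⟩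
  · intro y
    obtain ⟨x, rfl⟩ := hp.surjective y
    exact ⟨Quotient.mk _ x, rfl⟩
  · intro z
    induction z using Quotient.inductionOn with | _ x
    have := congrArg (Quotient.lift p hlift) (hsemi x)
    exact this.symm.trans (hp.semiconj x)

end Group

end TopDyn

/-- For a minimal distal system `(X, T)`: the maximal equicontinuous factor exists and is a
rotation on a compact abelian group; however it is realized as such a rotation, it characterizes
the parallelograms; and the parallelograms are characterized by sequences. -/
theorem mainTheorem6 {X : Type u} [MetricSpace X] [CompactSpace X] [Nonempty X]
    (T : X ≃ₜ X) (hmin : TopDyn.IsMinimalSystem T) (hdist : TopDyn.IsDistalSystem T) :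
    (∃ (Z : Type u) (_ : CommGroup Z) (_ : MetricSpace Z) (_ : CompactSpace Z)
        (_ : IsTopologicalGroup Z) (α : Z) (π : X → Z),
        TopDyn.IsMaximalEquicontinuousFactor T (Homeomorph.mulLeft α) π) ∧
    (∀ (Z : Type v) [CommGroup Z] [MetricSpace Z] [CompactSpace Z] [IsTopologicalGroup Z]
        (α : Z) (π : X → Z),
        TopDyn.IsMaximalEquicontinuousFactor T (Homeomorph.mulLeft α) π →
        ∀ x₀ x₁ x₂ x₃ : X, (x₀, x₁, x₂, x₃) ∈ TopDyn.parallelograms T ↔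
          π x₀ * (π x₁)⁻¹ * (π x₂)⁻¹ * π x₃ = 1) ∧
    (∀ x₀ x₁ x₂ x₃ : X, (x₀, x₁, x₂, x₃) ∈ TopDyn.parallelograms T ↔
        ∃ m n : ℕ → ℤ,
          Tendsto (fun i => (T ^ m i) x₀) atTop (𝓝 x₁) ∧
          Tendsto (fun i => (T ^ n i) x₀) atTop (𝓝 x₂) ∧
          Tendsto (fun i => (T ^ (m i + n i)) x₀) atTop (𝓝 x₃)) := by
  obtain ⟨e⟩ := ‹Nonempty X›
  have : Nonempty X := ⟨e⟩
  obtain ⟨Z₀, hG, hM, hC, hZ, α₀, π₀, hπ₀, hfib⟩ :=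
    TopDyn.exists_isMaximalEquicontinuousFactor hmin hdist e
  refine ⟨⟨Z₀, hG, hM, hC, hZ, α₀, π₀, hπ₀⟩, ?_,
    TopDyn.mem_parallelograms_iff_exists_seq hmin hdist⟩
  intro Z _ _ _ _ α π hπ x₀ x₁ x₂ x₃
  refine ⟨hπ.isFactorMap.mul_eq_one_of_mem_parallelograms, fun h => ?_⟩
  -- Complete the first three vertices by some `y`. The equation forces `π y = π x₃`; maximality
  -- transfers this to the model `Z₀`, whose fibres are known, and there `y` may be replaced by
  -- `x₃`.
  obtain ⟨y, hy⟩ := hmin.exists_mem_parallelograms x₀ x₁ x₂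
  have hxy : π y = π x₃ := mul_left_cancel
    ((hπ.isFactorMap.mul_eq_one_of_mem_parallelograms hy).trans h.symm)
  obtain ⟨q, -, hq⟩ := hπ.maximal Z₀ _ π₀ hπ₀.isFactorMap hπ₀.equicontinuous
  have hxy₀ : π₀ y = π₀ x₃ := by rw [← hq, ← hq, hxy]
  exact TopDyn.mem_parallelograms_congr_right hmin hdist hy (hfib y x₃ hxy₀)
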